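/- **Setting.** Let $d,n\ge 1$ be integers and $L,B>0$. Let $\mathcal S,\mathcal A$ be measurable spaces and $\phi:\mathcal S\times\mathcal A\to\mathbb R^d$ a measurable feature map with $\|\phi(s,a)\|_2\le L$ for all $(s,a)$. Let $\Theta_B=\{\theta\in\mathbb R^d:\langle\mathbf 1,\theta\rangle=0,\ \|\theta\|_2\le B\}$ and $\theta^*\in\Theta_B$. The dataset $\mathcal D=(s_i,a_i^0,a_i^1,y_i)_{i=1}^n$ consists of $n$ i.i.d. samples: $s_i\sim\rho$, $(a_i^0,a_i^1)\sim\mu(\cdot\mid s_i)$, where $\rho$ is a probability distribution on $\mathcal S$ and $\mu$ a Markov kernel from $\mathcal S$ to $\mathcal A\times\mathcal A$, and $y_i\in\{0,1\}$ with $$\mathbb P[y_i=l\mid s_i,a_i^0,a_i^1]=\frac{\exp(\phi(s_i,a_i^l)^\top\theta^*)}{\exp(\phi(s_i,a_i^0)^\top\theta^*)+\exp(\phi(s_i,a_i^1)^\top\theta^*)},\qquad l\in\{0,1\}.$$ Put $x_i=\phi(s_i,a_i^1)-\phi(s_i,a_i^0)$, $\Sigma_{\mathcal D}=\frac1n\sum_{i=1}^n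 x_ix_i^\top$, $\operatorname{sig}(z)=1/(1+e^{-z})$, $\|v\|_M=\sqrt{v^\top Mv}$, and $$l_{\mathcal D}(\theta)=-\sum_{i=1}^n\Big[\mathbf 1(y_i=1)\log \operatorname{sig}(x_i^\top\theta)+\mathbf 1(y_i=0)\log\big(1-\operatorname{sig}(x_i^\top\theta)\big)\Big],\qquad \gamma=\frac{1}{2+e^{-2LB}+e^{2LB}}.$$ For $\sigma>0$ and $\alpha\in(0,1)$ let $$\beta=\frac{\sigma\sqrt{d\log(1/\alpha)}}{B},\qquad \lambda'=\frac{\beta}{\gamma n}=\frac{\sigma\sqrt{d\log(1/\alpha)}}{\gamma nB},\qquad \hat\theta_{\mathrm{obj}}=\operatorname*{arg\,min}_{\theta\in\Theta_B}\Big(l_{\mathcal D}(\theta)+\frac\beta2\|\theta\|_2^2+w^\top\theta\Big),$$ where $w\sim\mathcal N(0,\sigma^2I_d)$ is independent of $\mathcal D$. A randomized algorithm $\mathcal M$ is $(\epsilon,\delta)$-label DP (in the central model) if $\mathbb P[\mathcal M(\mathcal D)\in T]\le e^\epsilon\,\mathbb P[\mathcal M(\mathcal D')\in T]+\delta$ for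 all measurable $T$ and all datasets $\mathcal D,\mathcal D'$ that differ only in the label of a single sample, the probability being over the randomness of $\mathcal M$. **Theorem.** For every $\alpha_0\in(0,1)$ there is a constant $C>0$, depending only on $\alpha_0$, such that in the above setting, for every $\alpha\in(0,\alpha_0]$: 1. For every $\sigma>0$, with probability at least $1-\alpha$ (over $\mathcal D$ and $w$), $$\|\hat\theta_{\mathrm{obj}}-\theta^*\|_{\Sigma_{\mathcal D}+\lambda'I}\le C\left(\frac1\gamma\sqrt{\frac{d+\log(1/\alpha)}{n}}+\frac{\sqrt{\sigma B}\,(d\log(1/\alpha))^{1/4}}{\sqrt{n\gamma}}\right).$$ 2. For every $\epsilon>0$ and $\delta\in(0,1)$, with $\sigma=\frac{L\sqrt{8\log(2/\delta)+4\epsilon}}{\epsilon}$, the algorithm $\mathcal D\mapsto\hat\theta_{\mathrm{obj}}$ is $(\epsilon,\delta)$-label DP in the central model, and with probability at least $1-\alpha$, $$\|\hat\theta_{\mathrm{obj}}-\theta^*\|_{\Sigma_{\mathcal D}+\lambda'I}\le C\left(\frac1\gamma\sqrt{\frac{d+\log(1/\alpha)}{n}}+\frac{\sqrt{LB}\,\big((\log(2/\delta)+4\epsilon)\,d\log(1/\alpha)\big)^{1/4}}{\sqrt{n\epsilon\gamma}}\right).$$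 -/

import Mathlib

open MeasureTheory ProbabilityTheory

universe u v

namespace BTL

/-- The parameter set `Θ_B = {θ ∈ ℝ^d | ⟨1, θ⟩ = 0, ‖θ‖₂ ≤ B}`. -/
def paramSet (d : ℕ) (B : ℝ) : Set (EuclideanSpace ℝ (Fin d)) :=
  {θ | ∑ j, θ j = 0 ∧ ‖θ‖ ≤ B}

section Model

variable {S A : Type*} {d : ℕ}

/-- The linear reward `r_θ(s, a) = φ(s, a)ᵀ θ`. -/
noncomputable def reward (φ : S → A → EuclideanSpace ℝ (Fin d))
    (θ : EuclideanSpace ℝ (Fin d)) (s : S) (a : A) : ℝ :=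
  inner ℝ (φ s a) θ

/-- The Bradley-Terry-Luce probability of the label `l`, given the state and the pair of actions
`z = (s, (a⁰, a¹))`; the label `true` stands for `1` and `false` for `0`. -/
noncomputable def labelProb (φ : S → A → EuclideanSpace ℝ (Fin d))
    (θ : EuclideanSpace ℝ (Fin d)) (z : S × (A × A)) (l : Bool) : ℝ :=
  Real.exp (reward φ θ z.1 (if l then z.2.2 else z.2.1)) /
    (Real.exp (reward φ θ z.1 z.2.1) + Real.exp (reward φ θ z.1 z.2.2))

/-- The differential feature `φ(s, a¹) - φ(s, a⁰)`. -/
noncomputable def diffFeature (φ : S → A → EuclideanSpace ℝ (Fin d)) (z : S × (A × A)) :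
    EuclideanSpace ℝ (Fin d) :=
  φ z.1 z.2.2 - φ z.1 z.2.1

variable [MeasurableSpace S] [MeasurableSpace A]

theorem measurable_labelProb {φ : S → A → EuclideanSpace ℝ (Fin d)}
    (hφ : Measurable (Function.uncurry φ)) (θ : EuclideanSpace ℝ (Fin d)) (l : Bool) :
    Measurable fun z => labelProb φ θ z l := by
  have h0 : Measurable fun z : S × (A × A) => φ z.1 z.2.1 :=
    hφ.comp (measurable_fst.prodMk (measurable_fst.comp measurable_snd))
  have h1 : Measurable fun z : S × (A × A) => φ z.1 z.2.2 :=
    hφ.comp (measurable_fst.prodMk (measurable_snd.comp measurable_snd))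
  unfold labelProb reward
  cases l <;> simp only [if_true, Bool.false_eq_true, if_false] <;> fun_prop

/-- The conditional law of a label given the state and the pair of actions. -/
noncomputable def labelKernel (φ : S → A → EuclideanSpace ℝ (Fin d))
    (hφ : Measurable (Function.uncurry φ)) (θ : EuclideanSpace ℝ (Fin d)) :
    Kernel (S × (A × A)) Bool where
  toFun z := ENNReal.ofReal (labelProb φ θ z true) • Measure.dirac true +
    ENNReal.ofReal (labelProb φ θ z false) • Measure.dirac false
  measurable' := by
    refine Measure.measurable_of_measurable_coe _ fun s hs => ?_
    simp only [Measure.coe_add, Measure.coe_smul, Pi.add_apply, Pi.smul_apply, smul_eq_mul]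
    exact ((measurable_labelProb hφ θ true).ennreal_ofReal.mul_const _).add
      ((measurable_labelProb hφ θ false).ennreal_ofReal.mul_const _)

instance isMarkovKernel_labelKernel (φ : S → A → EuclideanSpace ℝ (Fin d))
    (hφ : Measurable (Function.uncurry φ)) (θ : EuclideanSpace ℝ (Fin d)) :
    IsMarkovKernel (labelKernel φ hφ θ) := by
  refine ⟨fun z => ⟨?_⟩⟩
  have h : ∀ l, 0 ≤ labelProb φ θ z l := fun l => by unfold labelProb; positivity
  have hs : labelProb φ θ z true + labelProb φ θ z false = 1 := by
    have h1 := Real.exp_pos (reward φ θ z.1 z.2.1)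
    have h2 := Real.exp_pos (reward φ θ z.1 z.2.2)
    simp only [labelProb, if_true, Bool.false_eq_true, if_false]
    field_simp
    ring
  change (ENNReal.ofReal (labelProb φ θ z true) • Measure.dirac true +
    ENNReal.ofReal (labelProb φ θ z false) • Measure.dirac false) Set.univ = 1
  simp [← ENNReal.ofReal_add (h true) (h false), hs]

/-- The law of one sample `((s, (a⁰, a¹)), y)`: the state is drawn from `ρ`, the actions from the
behaviour policy `μ` given the state, the label from the Bradley-Terry-Luce model. -/
noncomputable def sampleLaw (φ : S → A → EuclideanSpace ℝ (Fin d))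
    (hφ : Measurable (Function.uncurry φ)) (θ : EuclideanSpace ℝ (Fin d))
    (ρ : Measure S) (μ : Kernel S (A × A)) : Measure ((S × (A × A)) × Bool) :=
  (ρ ⊗ₘ μ) ⊗ₘ labelKernel φ hφ θ

end Model

/-- The law `N(0, σ² I)` on `ℝ^d`. -/
noncomputable def noiseLaw (d : ℕ) (σ : ℝ) : Measure (EuclideanSpace ℝ (Fin d)) :=
  (stdGaussian (EuclideanSpace ℝ (Fin d))).map fun w => σ • w

section Estimator

variable {d n : ℕ}

/-- The negative log-likelihood
`-∑ i, (1(y_i = 1) log σ(x_iᵀ θ) + 1(y_i = 0) log (1 - σ(x_iᵀ θ)))`. -/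
noncomputable def negLogLik (x : Fin n → EuclideanSpace ℝ (Fin d)) (y : Fin n → Bool)
    (θ : EuclideanSpace ℝ (Fin d)) : ℝ :=
  -∑ i, if y i then Real.log (Real.sigmoid (inner ℝ (x i) θ))
    else Real.log (1 - Real.sigmoid (inner ℝ (x i) θ))

/-- The perturbed objective `l(θ) + (β / 2) ‖θ‖² + wᵀ θ`. -/
noncomputable def perturbedObj (β : ℝ) (x : Fin n → EuclideanSpace ℝ (Fin d)) (y : Fin n → Bool)
    (w θ : EuclideanSpace ℝ (Fin d)) : ℝ :=
  negLogLik x y θ + β / 2 * ‖θ‖ ^ 2 + inner ℝ w θ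

theorem isCompact_paramSet (d : ℕ) (B : ℝ) : IsCompact (paramSet d B) := by
  have h : paramSet d B = {θ | ∑ j, θ j = 0} ∩ Metric.closedBall 0 B := by
    ext θ; simp [paramSet]
  rw [h]
  refine (isCompact_closedBall _ _).inter_left ?_
  exact isClosed_eq (by fun_prop) continuous_const

theorem continuous_perturbedObj (β : ℝ) (x : Fin n → EuclideanSpace ℝ (Fin d)) (y : Fin n → Bool)
    (w : EuclideanSpace ℝ (Fin d)) : Continuous (perturbedObj β x y w) := by
  have hl : Continuous (negLogLik x y) := by
    unfold negLogLik
    refine (continuous_finsetSum _ fun i _ => ?_).neg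
    have hs : Continuous fun θ : EuclideanSpace ℝ (Fin d) =>
        Real.sigmoid (inner ℝ (x i) θ) := by
      simp only [Real.sigmoid_def]
      refine Continuous.inv₀ (by fun_prop) fun θ => by positivity
    cases y i
    · simp only [Bool.false_eq_true, if_false]
      exact (continuous_const.sub hs).log fun θ => (sub_pos.2 (Real.sigmoid_lt_one _)).ne'
    · simp only [if_true]
      exact hs.log fun θ => (Real.sigmoid_pos _).ne'
  unfold perturbedObj
  fun_prop

theorem exists_isMinOn_perturbedObj {B : ℝ} (hB : 0 ≤ B) (β : ℝ)
    (x : Fin n → EuclideanSpace ℝ (Fin d)) (y : Fin n → Bool) (w : EuclideanSpace ℝ (Fin d)) :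
    ∃ θ ∈ paramSet d B, IsMinOn (perturbedObj β x y w) (paramSet d B) θ :=
  (isCompact_paramSet d B).exists_isMinOn ⟨0, by simpa [paramSet] using hB⟩
    (continuous_perturbedObj β x y w).continuousOn

open Classical in
/-- The objective perturbation estimator: the minimizer over `Θ_B` of the perturbed objective
(unique when `β > 0`, the objective being strongly convex). -/
noncomputable def objPert (B β : ℝ) (x : Fin n → EuclideanSpace ℝ (Fin d)) (y : Fin n → Bool)
    (w : EuclideanSpace ℝ (Fin d)) : EuclideanSpace ℝ (Fin d) :=
  if h : ∃ θ ∈ paramSet d B, IsMinOn (perturbedObj β x y w) (paramSet d B) θ then h.choose else 0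

theorem objPert_spec {B : ℝ} (hB : 0 ≤ B) (β : ℝ)
    (x : Fin n → EuclideanSpace ℝ (Fin d)) (y : Fin n → Bool) (w : EuclideanSpace ℝ (Fin d)) :
    objPert B β x y w ∈ paramSet d B ∧
      IsMinOn (perturbedObj β x y w) (paramSet d B) (objPert B β x y w) := by
  have h := exists_isMinOn_perturbedObj hB β x y w
  rw [objPert, dif_pos h]
  exact h.choose_spec

/-- The estimator as a function of the dataset `D = (((s_i, (a_i⁰, a_i¹)), y_i))_i` and of the
noise vector `w`. -/
noncomputable def estimator {S A : Type*} (φ : S → A → EuclideanSpace ℝ (Fin d)) (B β : ℝ)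
    (D : Fin n → (S × (A × A)) × Bool) (w : EuclideanSpace ℝ (Fin d)) :
    EuclideanSpace ℝ (Fin d) :=
  objPert B β (fun i => diffFeature φ (D i).1) (fun i => (D i).2) w

/-- The sample covariance matrix `Σ = (1 / n) ∑ i, x_i x_iᵀ`. -/
noncomputable def sampleCov (x : Fin n → EuclideanSpace ℝ (Fin d)) : Matrix (Fin d) (Fin d) ℝ :=
  (1 / (n : ℝ)) • ∑ i, Matrix.vecMulVec (x i).ofLp (x i).ofLp

/-- The (semi-)norm `‖v‖_M = √(vᵀ M v)`. -/
noncomputable def matNorm (M : Matrix (Fin d) (Fin d) ℝ) (v : EuclideanSpace ℝ (Fin d)) : ℝ :=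
  Real.sqrt (v.ofLp ⬝ᵥ M.mulVec v.ofLp)

end Estimator

/-- `(ε, δ)`-label differential privacy in the central model. The dataset consists of pairs
(feature, label), and the randomized algorithm `M` draws its internal randomness from `ν`. -/
def IsLabelDP {n : ℕ} {Z Ω Θ : Type*} [MeasurableSpace Ω] [MeasurableSpace Θ] (ν : Measure Ω)
    (M : (Fin n → Z × Bool) → Ω → Θ) (ε δ : ℝ) : Prop :=
  ∀ D D' : Fin n → Z × Bool,
    (∃ j, (D j).1 = (D' j).1 ∧ ∀ i, i ≠ j → D i = D' i) →
    ∀ T : Set Θ, MeasurableSet T →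
      ν {ω | M D ω ∈ T} ≤ ENNReal.ofReal (Real.exp ε) * ν {ω | M D' ω ∈ T} + ENNReal.ofReal δ

/-- `γ = 1 / (2 + exp(-2LB) + exp(2LB))`. -/
noncomputable def gam (L B : ℝ) : ℝ :=
  1 / (2 + Real.exp (-2 * L * B) + Real.exp (2 * L * B))

/-- The regularizer `β = σ √(d log(1/α)) / B`. -/
noncomputable def regBeta (d : ℕ) (B σ α : ℝ) : ℝ :=
  σ * Real.sqrt (d * Real.log (1 / α)) / B

/-- `λ' = σ √(d log(1/α)) / (γ n B)`, which equals `β / (γ n)`. -/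
noncomputable def lam (d n : ℕ) (L B σ α : ℝ) : ℝ :=
  σ * Real.sqrt (d * Real.log (1 / α)) / (gam L B * n * B)

/-- The noise level `σ = L √(8 log(2/δ) + 4ε) / ε`. -/
noncomputable def privSigma (L ε δ : ℝ) : ℝ :=
  L * Real.sqrt (8 * Real.log (2 / δ) + 4 * ε) / ε

/-- The estimation error `‖θ̂ - θ*‖_{Σ_D + λ' I}` on the dataset `D` with noise vector `w`. -/
noncomputable def estError {d n : ℕ} {S A : Type*} (φ : S → A → EuclideanSpace ℝ (Fin d))
    (L B σ α : ℝ) (θs : EuclideanSpace ℝ (Fin d)) (D : Fin n → (S × (A × A)) × Bool)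
    (w : EuclideanSpace ℝ (Fin d)) : ℝ :=
  matNorm (sampleCov (fun i => diffFeature φ (D i).1) +
      lam d n L B σ α • (1 : Matrix (Fin d) (Fin d) ℝ))
    (estimator φ B (regBeta d B σ α) D w - θs)

end BTL

namespace BTL

open scoped ENNReal

/-! Privacy. Since log sig(u) = u + log(1 - sig(u)), the labels enter the objective only through the
linear term ⟨∑ yᵢ xᵢ, θ⟩ (`negLogLik_eq`). Changing one label is thus the same as translating the
noise w by a vector of norm at most 2L (`objPert_eq_of_labels`), and privacy is the Gaussian
mechanism followed by post-processing (`noiseLaw_add_le`).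

Utility. On Θ_B all arguments xᵢᵀθ lie in [-2LB, 2LB], where sig' ≥ γ. Comparing the objective at
the minimizer with its value at θ* gives a quadratic inequality for the error e, of the shape γne² ≤
2 · score + 4(βB² + B‖w‖) (`matNorm_objPert_sub_le`). The score is ⟨ξ, Xv⟩ with ξ the residuals and
X the design matrix. It is at most ‖Pξ‖‖Xv‖, with P the projection onto the range of X, of dimension
at most d. Given the features, ξ has independent centred bounded entries, so ‖Pξ‖² is of order d +
log(1/α) (`measure_score_le`). The same exponential moment bounds ‖w‖ (`noiseLaw_norm_le`). A union
bound, α/2 for each event, concludes. The constant depends on α₀ because d + log(1/α) has to be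
absorbed into d · log(1/α). -/

/-! ### Product measures, Gaussian shifts and the Gaussian mechanism -/

theorem lintegral_pi_prod {ι : Type*} [Fintype ι] {X : ι → Type*} [∀ i, MeasurableSpace (X i)]
    (μ : ∀ i, Measure (X i)) [∀ i, IsProbabilityMeasure (μ i)] (f : ∀ i, X i → ℝ≥0∞)
    (hf : ∀ i, Measurable (f i)) :
    ∫⁻ x, ∏ i, f i (x i) ∂Measure.pi μ = ∏ i, ∫⁻ x, f i x ∂μ i := by
  refine (lintegral_prod_eq_prod_lintegral_of_indepFun Finset.univ
    (fun i (x : ∀ i, X i) => f i (x i)) (iIndepFun_pi fun i => (hf i).aemeasurable)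
    fun i => (hf i).comp (measurable_pi_apply i)).trans ?_
  refine Finset.prod_congr rfl fun i _ => ?_
  exact (measurePreserving_eval μ i).lintegral_comp (hf i)

theorem lintegral_exp_sum_pi {ι : Type*} [Fintype ι] {X : ι → Type*} [∀ i, MeasurableSpace (X i)]
    (μ : ∀ i, Measure (X i)) [∀ i, IsProbabilityMeasure (μ i)] (f : ∀ i, X i → ℝ)
    (hf : ∀ i, Measurable (f i)) :
    ∫⁻ x, ENNReal.ofReal (Real.exp (∑ i, f i (x i))) ∂Measure.pi μ =
      ∏ i, ∫⁻ x, ENNReal.ofReal (Real.exp (f i x)) ∂μ i := by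
  rw [← lintegral_pi_prod μ (fun i x => ENNReal.ofReal (Real.exp (f i x)))
    fun i => (hf i).exp.ennreal_ofReal]
  refine lintegral_congr fun x => ?_
  rw [Real.exp_sum, ENNReal.ofReal_prod_of_nonneg fun i _ => (Real.exp_pos _).le]

/-- Completing the square in the exponent: this is the likelihood ratio of a shifted Gaussian. -/
theorem gaussianReal_withDensity_exp (a : ℝ) :
    (gaussianReal 0 1).withDensity (fun x => ENNReal.ofReal (Real.exp (a * x - a ^ 2 / 2))) =
      gaussianReal a 1 := by
  rw [gaussianReal_of_var_ne_zero _ one_ne_zero, gaussianReal_of_var_ne_zero _ one_ne_zero,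
    ← withDensity_mul _ (measurable_gaussianPDF _ _) (by fun_prop)]
  congr 1
  ext x
  rw [Pi.mul_apply, gaussianPDF, gaussianPDF, ← ENNReal.ofReal_mul (gaussianPDFReal_nonneg _ _ _),
    gaussianPDFReal, gaussianPDFReal, mul_assoc, ← Real.exp_add]
  congr 3
  push_cast
  ring

theorem pi_withDensity_exp {ι : Type*} [Fintype ι] (a : ι → ℝ) :
    (Measure.pi fun _ : ι => gaussianReal 0 1).withDensity
        (fun x => ENNReal.ofReal (Real.exp (∑ i, (a i * x i - a i ^ 2 / 2)))) =
      Measure.pi fun i => gaussianReal (a i) 1 := by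
  classical
  refine (Measure.pi_eq fun s hs => ?_).symm
  rw [withDensity_apply _ (MeasurableSet.univ_pi hs),
    ← lintegral_indicator (MeasurableSet.univ_pi hs)]
  have h : ∀ x : ι → ℝ, (Set.univ.pi s).indicator
      (fun x => ENNReal.ofReal (Real.exp (∑ i, (a i * x i - a i ^ 2 / 2)))) x =
      ∏ i, (s i).indicator
        (fun y => ENNReal.ofReal (Real.exp (a i * y - a i ^ 2 / 2))) (x i) := by
    intro x
    by_cases hx : x ∈ Set.univ.pi s
    · rw [Set.indicator_of_mem hx, Real.exp_sum,
        ENNReal.ofReal_prod_of_nonneg fun i _ => (Real.exp_pos _).le]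
      exact Finset.prod_congr rfl fun i _ => by rw [Set.indicator_of_mem (hx i trivial)]
    · rw [Set.indicator_of_notMem hx]
      obtain ⟨i, hi⟩ : ∃ i, x i ∉ s i := by simpa [Set.mem_pi] using hx
      exact (Finset.prod_eq_zero (Finset.mem_univ i) (Set.indicator_of_notMem hi _)).symm
  simp_rw [h]
  rw [lintegral_pi_prod _ (fun i => (s i).indicator
        (fun y => ENNReal.ofReal (Real.exp (a i * y - a i ^ 2 / 2))))
    fun i => Measurable.indicator (by fun_prop) (hs i)]
  refine Finset.prod_congr rfl fun i _ => ?_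
  rw [lintegral_indicator (hs i), ← withDensity_apply _ (hs i), gaussianReal_withDensity_exp]

theorem pi_gaussian_map_add {ι : Type*} [Fintype ι] (a : ι → ℝ) :
    (Measure.pi fun _ : ι => gaussianReal 0 1).map (fun x => x + a) =
      Measure.pi fun i => gaussianReal (a i) 1 := by
  have h : ∀ i, (gaussianReal 0 1).map (fun x => x + a i) = gaussianReal (a i) 1 := fun i => by
    rw [gaussianReal_map_add_const, zero_add]
  have hp : ∀ i, SigmaFinite ((gaussianReal 0 1).map (fun x => x + a i)) := fun i => by
    rw [h]; infer_instance
  simp_rw [← h]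
  exact Measure.pi_map_pi (f := fun i x => x + a i) fun i => by fun_prop

theorem lintegral_pi_gaussian_exp {ι : Type*} [Fintype ι] (a : ι → ℝ) :
    ∫⁻ x, ENNReal.ofReal (Real.exp (∑ i, (a i * x i - a i ^ 2 / 2)))
      ∂Measure.pi (fun _ : ι => gaussianReal 0 1) = 1 := by
  rw [← setLIntegral_univ, ← withDensity_apply _ MeasurableSet.univ, pi_withDensity_exp,
    measure_univ]

/-- The Gaussian mechanism for the standard Gaussian law and a shift `a`. -/
theorem pi_gaussian_le_map_add {ι : Type*} [Fintype ι] (a : ι → ℝ) {ε δ : ℝ} (hε : 0 < ε)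
    (hδ : 0 < δ) (hδ1 : δ < 1)
    (ha : (∑ i, a i ^ 2) * (2 * Real.log (2 / δ) + ε) ≤ ε ^ 2) {E : Set (ι → ℝ)}
    (hE : MeasurableSet E) :
    Measure.pi (fun _ : ι => gaussianReal 0 1) E ≤ ENNReal.ofReal (Real.exp ε) *
      (Measure.pi fun _ : ι => gaussianReal 0 1).map (fun x => x + a) E + ENNReal.ofReal δ := by
  set G := Measure.pi fun _ : ι => gaussianReal 0 1
  have hl : 0 < Real.log (2 / δ) := Real.log_pos (by rw [lt_div_iff₀ hδ]; linarith)
  set l := Real.log (2 / δ) with hl_def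
  set r := ∑ i, a i ^ 2 with hr
  have hr0 : 0 ≤ r := Finset.sum_nonneg fun i _ => sq_nonneg _
  -- `H` is where the privacy loss exceeds ε. Off `H` the density ratio is at least exp(-ε), which
  -- gives the multiplicative part; the mass of `H` pays for δ.
  set H : Set (ι → ℝ) := {x | ∑ i, (a i * x i - a i ^ 2 / 2) < -ε} with hH
  have hHm : MeasurableSet H := measurableSet_lt (by fun_prop) measurable_const
  have h1 : G (E \ H) ≤ ENNReal.ofReal (Real.exp ε) * G.map (fun x => x + a) E := by
    rw [pi_gaussian_map_add, ← pi_withDensity_exp, withDensity_apply _ hE,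
      ← lintegral_const_mul _ (by fun_prop)]
    calc G (E \ H) = ∫⁻ x in E \ H, 1 ∂G := by simp
      _ ≤ ∫⁻ x in E \ H, ENNReal.ofReal (Real.exp ε) *
          ENNReal.ofReal (Real.exp (∑ i, (a i * x i - a i ^ 2 / 2))) ∂G := by
        refine setLIntegral_mono (by fun_prop) fun x hx => ?_
        rw [← ENNReal.ofReal_mul (Real.exp_pos _).le, ← Real.exp_add, ENNReal.one_le_ofReal,
          Real.one_le_exp_iff]
        have := hx.2
        simp only [hH, Set.mem_ofPred_eq, not_lt] at this
        linarith
      _ ≤ _ := lintegral_mono_set Set.sdiff_subset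
  have h2 : G H ≤ ENNReal.ofReal δ := by
    -- Chernoff parameter. With q = 2l/ε the hypothesis reads r(q + 1) ≤ ε, and t = q + 1/2 makes
    -- t(t + 1) ≤ (q + 1)², so the exponent is at most -l and `H` has mass at most δ/2.
    set t := 2 * l / ε + 1 / 2 with ht
    have ht0 : 0 < t := by positivity
    have hexp : r / 2 * (t * (t + 1)) - t * ε ≤ -l := by
      have h3 : r * (2 * l / ε + 1) ≤ ε := by
        have : r * (2 * l / ε + 1) = r * (2 * l + ε) / ε := by field_simp
        rw [this, div_le_iff₀ hε]
        linarith
      have h4 : (2 * l / ε) * ε = 2 * l := by field_simp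
      have h5 : 0 < 2 * l / ε := by positivity
      set q := 2 * l / ε
      have h6 : r * (t * (t + 1)) ≤ ε * (q + 1) := by
        have : t * (t + 1) ≤ (q + 1) * (q + 1) := by rw [ht]; nlinarith
        calc r * (t * (t + 1)) ≤ r * ((q + 1) * (q + 1)) := by gcongr
          _ = (r * (q + 1)) * (q + 1) := by ring
          _ ≤ ε * (q + 1) := by gcongr
      rw [ht] at h6 ⊢
      nlinarith
    -- Chernoff bound written as a change of measure: the tilted density with shift `-t * a`
    -- integrates to 1, and times exp(-l) it is at least 1 on `H`.
    calc G H ≤ ∫⁻ x in H, ENNReal.ofReal (Real.exp (-l)) *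
          ENNReal.ofReal (Real.exp (∑ i, ((-t * a i) * x i - (-t * a i) ^ 2 / 2))) ∂G := by
          rw [← setLIntegral_one]
          refine setLIntegral_mono (by fun_prop) fun x hx => ?_
          rw [← ENNReal.ofReal_mul (Real.exp_pos _).le, ← Real.exp_add, ENNReal.one_le_ofReal,
            Real.one_le_exp_iff]
          have hx' : ∑ i, (a i * x i - a i ^ 2 / 2) < -ε := hx
          have e1 : ∑ i, ((-t * a i) * x i - (-t * a i) ^ 2 / 2) =
              -t * ∑ i, (a i * x i - a i ^ 2 / 2) - r / 2 * (t * (t + 1)) := by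
            rw [hr, Finset.mul_sum, Finset.sum_div, Finset.sum_mul, ← Finset.sum_sub_distrib]
            exact Finset.sum_congr rfl fun i _ => by ring
          rw [e1]
          nlinarith
      _ ≤ ∫⁻ x, ENNReal.ofReal (Real.exp (-l)) *
          ENNReal.ofReal (Real.exp (∑ i, ((-t * a i) * x i - (-t * a i) ^ 2 / 2))) ∂G :=
          setLIntegral_le_lintegral _ _
      _ = ENNReal.ofReal (Real.exp (-l)) := by
          rw [lintegral_const_mul _ (by fun_prop),
            lintegral_pi_gaussian_exp (fun i => -t * a i), mul_one]
      _ ≤ ENNReal.ofReal δ := by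
          refine ENNReal.ofReal_le_ofReal ?_
          rw [hl_def, Real.exp_neg, Real.exp_log (by positivity), inv_div]
          linarith
  calc G E ≤ G (E \ H ∪ H) := measure_mono (by simp)
    _ ≤ G (E \ H) + G H := measure_union_le _ _
    _ ≤ _ := add_le_add h1 h2

/-! ### Exponential moments and tail bounds -/

/-- The exponential moment `E exp(g² / 8)` of a standard Gaussian variable. -/
noncomputable def sqExpMoment : ℝ≥0∞ :=
  ∫⁻ x, ENNReal.ofReal (Real.exp (x ^ 2 / 8)) ∂gaussianReal 0 1

theorem sqExpMoment_ne_top : sqExpMoment ≠ ∞ := by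
  rw [sqExpMoment, gaussianReal_of_var_ne_zero _ one_ne_zero,
    lintegral_withDensity_eq_lintegral_mul _ (measurable_gaussianPDF _ _) (by fun_prop)]
  have h : ∀ x : ℝ, (gaussianPDF 0 1 * fun x => ENNReal.ofReal (Real.exp (x ^ 2 / 8))) x =
      ENNReal.ofReal ((√(2 * Real.pi * 1))⁻¹ * Real.exp (-(3 / 8) * x ^ 2)) := by
    intro x
    rw [Pi.mul_apply, gaussianPDF, ← ENNReal.ofReal_mul (gaussianPDFReal_nonneg _ _ _),
      gaussianPDFReal, mul_assoc, ← Real.exp_add]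
    congr 3
    push_cast
    ring
  simp_rw [h]
  exact ((integrable_exp_neg_mul_sq (by norm_num : (0 : ℝ) < 3 / 8)).const_mul _).lintegral_lt_top.ne

theorem one_le_sqExpMoment : 1 ≤ sqExpMoment := by
  calc (1 : ℝ≥0∞) = ∫⁻ _, 1 ∂gaussianReal 0 1 := by simp
    _ ≤ _ := lintegral_mono fun x => by
      rw [ENNReal.one_le_ofReal, Real.one_le_exp_iff]; positivity

/-- If `E exp(f) ≤ K ^ d` then `f` exceeds `d log K + log (1 / α)` with probability at most `α`. -/
theorem measure_le_of_lintegral_exp {Ω : Type*} [MeasurableSpace Ω] (P : Measure Ω) {f : Ω → ℝ}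
    (hf : Measurable f) {K α : ℝ} (hK : 0 < K) (hα : 0 < α) (d : ℕ)
    (h : ∫⁻ x, ENNReal.ofReal (Real.exp (f x)) ∂P ≤ ENNReal.ofReal K ^ d) :
    P {x | d * Real.log K + Real.log (1 / α) ≤ f x} ≤ ENNReal.ofReal α := by
  have h1 := mul_meas_ge_le_lintegral (μ := P) hf.exp.ennreal_ofReal
    (ENNReal.ofReal (K ^ d * (1 / α)))
  have h2 : {x | d * Real.log K + Real.log (1 / α) ≤ f x} ⊆
      {x | ENNReal.ofReal (K ^ d * (1 / α)) ≤ ENNReal.ofReal (Real.exp (f x))} := by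
    intro x hx
    refine ENNReal.ofReal_le_ofReal ?_
    rw [← Real.log_le_iff_le_exp (by positivity), Real.log_mul (by positivity) (by positivity),
      Real.log_pow]
    exact hx
  have h3 : P {x | d * Real.log K + Real.log (1 / α) ≤ f x} * ENNReal.ofReal (K ^ d * (1 / α)) ≤
      ENNReal.ofReal K ^ d := by
    rw [mul_comm]
    exact (mul_le_mul_right (measure_mono h2) _).trans (h1.trans h)
  have h4 := (ENNReal.le_div_iff_mul_le (Or.inl (by simp; positivity)) (Or.inl (by simp))).2 h3
  refine h4.trans (le_of_eq ?_)
  rw [← ENNReal.ofReal_pow hK.le, ← ENNReal.ofReal_div_of_pos (by positivity)]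
  congr 1
  field_simp

/-! ### Label changes as noise shifts, and privacy -/

theorem log_sigmoid_eq (u : ℝ) :
    Real.log (Real.sigmoid u) = u + Real.log (1 - Real.sigmoid u) := by
  rw [← Real.sigmoid_neg, ← Real.sigmoid_mul_rexp_neg,
    Real.log_mul (Real.sigmoid_pos u).ne' (Real.exp_pos _).ne', Real.log_exp]
  ring

/-- The label as a real number. -/
def labelVal (y : Bool) : ℝ := if y then 1 else 0

section Shift

variable {d n : ℕ}

/-- Separates the labels, which appear linearly in θ, from a convex part that depends on the
features alone. -/
theorem negLogLik_eq (x : Fin n → EuclideanSpace ℝ (Fin d)) (y : Fin n → Bool)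
    (θ : EuclideanSpace ℝ (Fin d)) :
    negLogLik x y θ = -inner ℝ (∑ i, labelVal (y i) • x i) θ -
      ∑ i, Real.log (1 - Real.sigmoid (inner ℝ (x i) θ)) := by
  rw [negLogLik, sum_inner, ← neg_add', ← Finset.sum_add_distrib]
  congr 1
  refine Finset.sum_congr rfl fun i _ => ?_
  rw [real_inner_smul_left, labelVal]
  split_ifs
  · rw [log_sigmoid_eq]; ring
  · ring

/-- Changing labels amounts to a shift of the noise vector. -/
theorem objPert_eq_of_labels (B β : ℝ) (x : Fin n → EuclideanSpace ℝ (Fin d))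
    (y y' : Fin n → Bool) (w : EuclideanSpace ℝ (Fin d)) :
    objPert B β x y w = objPert B β x y'
      (w + ∑ i, (labelVal (y' i) - labelVal (y i)) • x i) := by
  have h : perturbedObj β x y w = perturbedObj β x y'
      (w + ∑ i, (labelVal (y' i) - labelVal (y i)) • x i) := by
    ext θ
    simp only [perturbedObj, negLogLik_eq, sub_smul, Finset.sum_sub_distrib, inner_add_left,
      inner_sub_left]
    ring
  unfold objPert
  rw [h]

theorem noiseLaw_apply (σ : ℝ) {E : Set (EuclideanSpace ℝ (Fin d))} (hE : MeasurableSet E) :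
    noiseLaw d σ E = Measure.pi (fun _ : Fin d => gaussianReal 0 1)
      {x | σ • WithLp.toLp 2 x ∈ E} := by
  rw [noiseLaw, ← map_pi_eq_stdGaussian, Measure.map_map (by fun_prop) (by fun_prop),
    Measure.map_apply (by fun_prop) hE]
  rfl

/-- The Gaussian mechanism with noise level `σ`, for a shift `v` and an arbitrary set `E`. -/
theorem noiseLaw_add_le {σ ε δ : ℝ} (hσ : 0 < σ) (hε : 0 < ε) (hδ : 0 < δ) (hδ1 : δ < 1)
    {v : EuclideanSpace ℝ (Fin d)}
    (hv : ‖v‖ ^ 2 * (2 * Real.log (2 / δ) + ε) ≤ σ ^ 2 * ε ^ 2)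
    (E : Set (EuclideanSpace ℝ (Fin d))) :
    noiseLaw d σ {w | w + v ∈ E} ≤
      ENNReal.ofReal (Real.exp ε) * noiseLaw d σ E + ENNReal.ofReal δ := by
  have key : ∀ F : Set (EuclideanSpace ℝ (Fin d)), MeasurableSet F →
      noiseLaw d σ {w | w + v ∈ F} ≤
        ENNReal.ofReal (Real.exp ε) * noiseLaw d σ F + ENNReal.ofReal δ := by
    intro F hF
    have hm : MeasurableSet {w | w + v ∈ F} := (measurable_id.add_const v) hF
    have hm' : Measurable fun x : Fin d → ℝ => σ • WithLp.toLp 2 x := by fun_prop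
    have hv' : ∑ i, (σ⁻¹ * v i) ^ 2 = ‖v‖ ^ 2 / σ ^ 2 := by
      simp_rw [mul_pow]
      rw [← Finset.mul_sum, EuclideanSpace.real_norm_sq_eq, inv_pow, inv_mul_eq_div]
    -- The event is {w + v ∈ F}; shifting back by -v/σ in standardized coordinates turns it into {w
    -- ∈ F}.
    have h := pi_gaussian_le_map_add (fun i => -(σ⁻¹ * v i)) hε hδ hδ1
      (by
        simp_rw [neg_sq]
        rw [hv', div_mul_eq_mul_div, div_le_iff₀ (by positivity)]
        linarith) (hm' hm)
    rw [noiseLaw_apply σ hm, noiseLaw_apply σ hF]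
    refine h.trans (le_of_eq ?_)
    rw [Measure.map_apply (by fun_prop) (hm' hm)]
    congr 3
    ext x
    have e : σ • WithLp.toLp 2 (x + fun i => -(σ⁻¹ * v i)) + v = σ • WithLp.toLp 2 x := by
      ext i
      simp
      field_simp
      ring
    change σ • WithLp.toLp 2 (x + fun i => -(σ⁻¹ * v i)) + v ∈ F ↔ _
    rw [e]
    rfl
  refine (measure_mono fun w hw => ?_).trans ((key _ (measurableSet_toMeasurable
    (noiseLaw d σ) E)).trans (le_of_eq ?_))
  -- Passing to a measurable hull, which has the same outer measure, allows arbitrary `E`. Hence no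
  -- measurability of the estimator is needed.
  · exact subset_toMeasurable (noiseLaw d σ) E hw
  · rw [measure_toMeasurable]

theorem norm_diffFeature_le {S A : Type*} {φ : S → A → EuclideanSpace ℝ (Fin d)} {L : ℝ}
    (hL : ∀ s a, ‖φ s a‖ ≤ L) (z : S × (A × A)) : ‖diffFeature φ z‖ ≤ 2 * L :=
  (norm_sub_le _ _).trans (by linarith [hL z.1 z.2.1, hL z.1 z.2.2])

theorem privSigma_pos {L ε δ : ℝ} (hL : 0 < L) (hε : 0 < ε) (hδ : 0 < δ) (hδ1 : δ < 1) :
    0 < privSigma L ε δ := by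
  have hl : 0 < Real.log (2 / δ) := Real.log_pos (by rw [lt_div_iff₀ hδ]; linarith)
  unfold privSigma
  positivity

/-- The features agree, so only the sample `j` contributes to the shift, by ±x_j or 0. The noise
level is calibrated to this sensitivity 2L: σ²ε² = (2L)²(2 log(2/δ) + ε). -/
theorem isLabelDP_estimator {S A : Type*} {φ : S → A → EuclideanSpace ℝ (Fin d)} {L : ℝ}
    (hL0 : 0 < L) (hL : ∀ s a, ‖φ s a‖ ≤ L) (B β : ℝ) {ε δ : ℝ} (hε : 0 < ε) (hδ : 0 < δ)
    (hδ1 : δ < 1) :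
    IsLabelDP (n := n) (noiseLaw d (privSigma L ε δ)) (estimator φ B β) ε δ := by
  rintro D D' ⟨j, hj, hD⟩ T -
  have hl : 0 < Real.log (2 / δ) := Real.log_pos (by rw [lt_div_iff₀ hδ]; linarith)
  have hx : (fun i => diffFeature φ (D i).1) = fun i => diffFeature φ (D' i).1 := by
    ext1 i
    by_cases h : i = j
    · rw [h, hj]
    · rw [hD i h]
  set v := ∑ i, (labelVal (D' i).2 - labelVal (D i).2) • diffFeature φ (D' i).1 with hv
  have hM : ∀ w, estimator φ B β D w = estimator φ B β D' (w + v) := by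
    intro w
    rw [estimator, estimator, hx]
    exact objPert_eq_of_labels B β _ _ _ w
  have hvn : ‖v‖ ≤ 2 * L := by
    rw [hv, Finset.sum_eq_single j (fun i _ h => by rw [hD i h]; simp) (by simp), norm_smul]
    have h1 : ‖labelVal (D' j).2 - labelVal (D j).2‖ ≤ 1 := by
      unfold labelVal
      split_ifs <;> norm_num
    calc _ ≤ 1 * (2 * L) :=
          mul_le_mul h1 (norm_diffFeature_le hL _) (norm_nonneg _) zero_le_one
      _ = 2 * L := one_mul _
  simp_rw [hM]
  refine noiseLaw_add_le (privSigma_pos hL0 hε hδ hδ1) hε hδ hδ1 ?_ {w | estimator φ B β D' w ∈ T}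
  have hs : privSigma L ε δ ^ 2 * ε ^ 2 = L ^ 2 * (8 * Real.log (2 / δ) + 4 * ε) := by
    rw [privSigma, div_pow, mul_pow, Real.sq_sqrt (by positivity)]
    field_simp
  rw [hs]
  calc ‖v‖ ^ 2 * (2 * Real.log (2 / δ) + ε) ≤ (2 * L) ^ 2 * (2 * Real.log (2 / δ) + ε) := by
        gcongr
    _ = _ := by ring

end Shift

/-! ### Strong convexity and the deterministic error bound -/

theorem gam_pos (L B : ℝ) : 0 < gam L B := by
  unfold gam
  positivity

/-- The derivative of the sigmoid is 1/(2 + 2 cosh u), smallest where |u| is largest. -/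
theorem gam_le_sigmoid_mul {L B u : ℝ} (hu : |u| ≤ 2 * L * B) :
    gam L B ≤ Real.sigmoid u * (1 - Real.sigmoid u) := by
  have h1 : Real.sigmoid u * (1 - Real.sigmoid u) = 1 / (2 + Real.exp (-u) + Real.exp u) := by
    rw [← Real.sigmoid_neg, Real.sigmoid_def, Real.sigmoid_def, neg_neg, ← mul_inv, one_div]
    congr 1
    have : Real.exp (-u) * Real.exp u = 1 := by rw [← Real.exp_add]; simp
    linear_combination this
  have h2 : Real.cosh u ≤ Real.cosh (2 * L * B) :=
    Real.cosh_le_cosh.2 (hu.trans (le_abs_self _))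
  rw [Real.cosh_eq, Real.cosh_eq] at h2
  rw [h1, gam]
  have h3 : -2 * L * B = -(2 * L * B) := by ring
  rw [h3]
  exact one_div_le_one_div_of_le (by positivity) (by linarith)

theorem hasDerivAt_neg_log_one_sub_sigmoid (u : ℝ) :
    HasDerivAt (fun u => -Real.log (1 - Real.sigmoid u)) (Real.sigmoid u) u := by
  have h := sub_pos.2 (Real.sigmoid_lt_one u)
  convert! (((Real.hasDerivAt_sigmoid u).const_sub 1).log h.ne').neg using 1
  field_simp

/-- Subtracting γu²/2 leaves a convex function on [-2LB, 2LB], which lies above its tangent at u₀.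
-/
theorem neg_log_one_sub_sigmoid_ge {L B u u₀ : ℝ} (hu : |u| ≤ 2 * L * B)
    (hu₀ : |u₀| ≤ 2 * L * B) :
    -Real.log (1 - Real.sigmoid u₀) + Real.sigmoid u₀ * (u - u₀) + gam L B / 2 * (u - u₀) ^ 2 ≤
      -Real.log (1 - Real.sigmoid u) := by
  set R := 2 * L * B
  set k : ℝ → ℝ := fun u => -Real.log (1 - Real.sigmoid u) - gam L B / 2 * u ^ 2
  have hk : ∀ u, HasDerivAt k (Real.sigmoid u - gam L B * u) u := fun u => by
    convert! (hasDerivAt_neg_log_one_sub_sigmoid u).sub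
      ((hasDerivAt_pow 2 u).const_mul (gam L B / 2)) using 1
    push_cast
    ring
  have hk' : deriv k = fun u => Real.sigmoid u - gam L B * u := funext fun u => (hk u).deriv
  have hmono : MonotoneOn (fun u => Real.sigmoid u - gam L B * u) (Set.Icc (-R) R) := by
    have hd : ∀ u, HasDerivAt (fun u => Real.sigmoid u - gam L B * u)
        (Real.sigmoid u * (1 - Real.sigmoid u) - gam L B) u := fun u => by
      convert! (Real.hasDerivAt_sigmoid u).sub ((hasDerivAt_id u).const_mul (gam L B)) using 1
      simp
    refine monotoneOn_of_deriv_nonneg (convex_Icc _ _)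
      (fun u _ => (hd u).continuousAt.continuousWithinAt)
      (fun u _ => (hd u).differentiableAt.differentiableWithinAt) fun u hu => ?_
    rw [(hd u).deriv, sub_nonneg]
    exact gam_le_sigmoid_mul (abs_le.2 (Set.mem_Icc.1 (interior_subset hu)))
  have hc : ConvexOn ℝ (Set.Icc (-R) R) k := by
    refine MonotoneOn.convexOn_of_deriv (convex_Icc _ _)
      (fun u _ => (hk u).continuousAt.continuousWithinAt)
      (fun u _ => (hk u).differentiableAt.differentiableWithinAt) ?_
    rw [hk']
    exact hmono.mono interior_subset
  have hkk : k u₀ + (Real.sigmoid u₀ - gam L B * u₀) * (u - u₀) ≤ k u := by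
    rcases lt_trichotomy u u₀ with h | h | h
    · have := hc.slope_le_of_hasDerivAt (abs_le.1 hu) (abs_le.1 hu₀) h (hk u₀)
      rw [slope_def_field, div_le_iff₀ (sub_pos.2 h)] at this
      linarith
    · subst h; simp
    · have := hc.le_slope_of_hasDerivAt (abs_le.1 hu₀) (abs_le.1 hu) h (hk u₀)
      rw [slope_def_field, le_div_iff₀ (sub_pos.2 h)] at this
      linarith
  simp only [k] at hkk
  linarith

section Deterministic

variable {d n : ℕ}

/-- The residuals `y_i - sig(x_iᵀ θ)`. -/
noncomputable def resid (θ : EuclideanSpace ℝ (Fin d)) (x : EuclideanSpace ℝ (Fin d)) (y : Bool) :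
    ℝ :=
  labelVal y - Real.sigmoid (inner ℝ x θ)

/-- Sums the scalar bound over the samples; the linear label term is exact and combines with
sig(xᵢᵀθ*) into the residuals. -/
theorem negLogLik_ge {L B : ℝ} {x : Fin n → EuclideanSpace ℝ (Fin d)}
    (hx : ∀ i, ‖x i‖ ≤ 2 * L) (y : Fin n → Bool) {θ θs : EuclideanSpace ℝ (Fin d)}
    (hθ : ‖θ‖ ≤ B) (hθs : ‖θs‖ ≤ B) :
    negLogLik x y θs - ∑ i, resid θs (x i) (y i) * inner ℝ (x i) (θ - θs) +
      gam L B / 2 * ∑ i, (inner ℝ (x i) (θ - θs)) ^ 2 ≤ negLogLik x y θ := by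
  have hb : ∀ i, ∀ t : EuclideanSpace ℝ (Fin d), ‖t‖ ≤ B → |inner ℝ (x i) t| ≤ 2 * L * B :=
    fun i t ht => (abs_real_inner_le_norm _ _).trans
      (mul_le_mul (hx i) ht (norm_nonneg _) ((norm_nonneg _).trans (hx i)))
  rw [negLogLik_eq, negLogLik_eq, sum_inner, sum_inner, Finset.mul_sum]
  simp_rw [real_inner_smul_left]
  have h := Finset.sum_le_sum fun i (_ : i ∈ Finset.univ) =>
    neg_log_one_sub_sigmoid_ge (hb i θ hθ) (hb i θs hθs)
  simp only [Finset.sum_add_distrib, Finset.sum_neg_distrib] at h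
  simp only [resid, inner_sub_right, sub_mul, mul_sub, Finset.sum_sub_distrib] at h ⊢
  linarith

theorem matNorm_sq (x : Fin n → EuclideanSpace ℝ (Fin d)) {l : ℝ} (hl : 0 ≤ l)
    (v : EuclideanSpace ℝ (Fin d)) :
    matNorm (sampleCov x + l • (1 : Matrix (Fin d) (Fin d) ℝ)) v ^ 2 =
      1 / n * ∑ i, (inner ℝ (x i) v) ^ 2 + l * ‖v‖ ^ 2 := by
  have h : v.ofLp ⬝ᵥ (sampleCov x + l • (1 : Matrix (Fin d) (Fin d) ℝ)).mulVec v.ofLp =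
      1 / n * ∑ i, (inner ℝ (x i) v) ^ 2 + l * ‖v‖ ^ 2 := by
    rw [Matrix.add_mulVec, dotProduct_add, sampleCov, Matrix.smul_mulVec, Matrix.smul_mulVec,
      dotProduct_smul, dotProduct_smul, Matrix.one_mulVec, smul_eq_mul, smul_eq_mul,
      Matrix.sum_mulVec, dotProduct_sum, EuclideanSpace.real_norm_sq_eq]
    congr 2
    · refine Finset.sum_congr rfl fun i _ => ?_
      rw [Matrix.vecMulVec_mulVec, EuclideanSpace.inner_eq_star_dotProduct]
      simp [dotProduct_comm, sq]
    · simp [dotProduct, sq]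
  rw [matNorm, h, Real.sq_sqrt]
  positivity

/-- The deterministic error bound, given a bound on the score and on the noise. -/
theorem matNorm_objPert_sub_le (hn : 0 < n) {L B β l c r : ℝ} (hB : 0 < B) (hβ : 0 ≤ β)
    (hc : 0 ≤ c) (hl : 0 ≤ l) (hlβ : gam L B * n * l = β)
    {x : Fin n → EuclideanSpace ℝ (Fin d)} (hx : ∀ i, ‖x i‖ ≤ 2 * L) (y : Fin n → Bool)
    {w θs : EuclideanSpace ℝ (Fin d)} (hθs : θs ∈ paramSet d B) (hw : ‖w‖ ≤ r)
    (hs : ∀ v : EuclideanSpace ℝ (Fin d), ∑ i, resid θs (x i) (y i) * inner ℝ (x i) v ≤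
      c * √(∑ i, (inner ℝ (x i) v) ^ 2)) :
    matNorm (sampleCov x + l • (1 : Matrix (Fin d) (Fin d) ℝ)) (objPert B β x y w - θs) ≤
      2 * (c / (gam L B * √n)) + √(4 * (β * B ^ 2 + B * r) / (gam L B * n)) := by
  obtain ⟨hθ, hmin⟩ := objPert_spec hB.le β x y w
  set θ := objPert B β x y w
  set v := θ - θs with hv
  have hn' : (0 : ℝ) < n := Nat.cast_pos.2 hn
  have hg := gam_pos L B
  have hr : 0 ≤ r := (norm_nonneg _).trans hw
  have hopt : perturbedObj β x y w θ ≤ perturbedObj β x y w θs := hmin hθs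
  have hlik := negLogLik_ge hx y hθ.2 hθs.2
  have hsv := hs v
  have hsq := matNorm_sq x hl v
  set e := matNorm (sampleCov x + l • (1 : Matrix (Fin d) (Fin d) ℝ)) v
  have he0 : 0 ≤ e := Real.sqrt_nonneg _
  set Q := ∑ i, (inner ℝ (x i) v) ^ 2 with hQ
  have hQ0 : 0 ≤ Q := Finset.sum_nonneg fun i _ => sq_nonneg _
  have hvB : ‖v‖ ≤ 2 * B := (norm_sub_le _ _).trans (by linarith [hθ.2, hθs.2])
  -- The ridge part of the norm is nonnegative, so the empirical part is at most n · e².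
  have hQe : √Q ≤ √n * e := by
    rw [← Real.sqrt_sq he0, ← Real.sqrt_mul hn'.le]
    refine Real.sqrt_le_sqrt ?_
    rw [hsq, mul_add, ← mul_assoc, mul_one_div_cancel hn'.ne', one_mul]
    have : 0 ≤ (n : ℝ) * (l * ‖v‖ ^ 2) := by positivity
    linarith
  have hnorm : ‖θ‖ ^ 2 - ‖θs‖ ^ 2 = ‖v‖ ^ 2 + 2 * inner ℝ θs v := by
    have : θ = θs + v := by rw [hv]; abel
    rw [this, norm_add_sq_real]
    ring
  have h1 : -(inner ℝ θs v) ≤ 2 * B ^ 2 := by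
    have h := (abs_real_inner_le_norm θs v).trans
      (mul_le_mul hθs.2 hvB (norm_nonneg _) hB.le)
    linarith [neg_abs_le (inner ℝ θs v : ℝ)]
  have h2 : -(inner ℝ w v) ≤ 2 * B * r := by
    have h := (abs_real_inner_le_norm w v).trans (mul_le_mul hw hvB (norm_nonneg _) hr)
    linarith [neg_abs_le (inner ℝ w v : ℝ)]
  have h3 : inner ℝ w θ - inner ℝ w θs = (inner ℝ w v : ℝ) := by rw [hv, inner_sub_right]
  -- Twice the sum of optimality and strong convexity. The choice λ' = β/(γn) makes γne² exactly γQ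
  -- + β‖v‖²; the cross terms with θ* and w are bounded using ‖v‖ ≤ 2B.
  have hkey : gam L B * n * e ^ 2 ≤ 2 * (c * (√n * e)) + 4 * (β * B ^ 2 + B * r) := by
    have h4 : gam L B * n * e ^ 2 = gam L B * Q + β * ‖v‖ ^ 2 := by
      rw [hsq, ← hlβ]
      field_simp
    have h5 : c * √Q ≤ c * (√n * e) := mul_le_mul_of_nonneg_left hQe hc
    have h6 : β * -(inner ℝ θs v) ≤ β * (2 * B ^ 2) := mul_le_mul_of_nonneg_left h1 hβ
    unfold perturbedObj at hopt
    rw [h4]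
    linear_combination 2 * hopt + 2 * hlik + 2 * hsv + 2 * h5 + 2 * h6 + 2 * h2 - 2 * h3 -
      β * hnorm
  set a := c / (gam L B * √n)
  set b := 4 * (β * B ^ 2 + B * r) / (gam L B * n)
  have hsn : 0 < √(n : ℝ) := Real.sqrt_pos.2 hn'
  have ha : 0 ≤ a := by positivity
  have hb : 0 ≤ b := by positivity
  have hquad : e ^ 2 ≤ 2 * a * e + b := by
    have h7 : gam L B * n * (2 * a * e + b) = 2 * (c * (√n * e)) + 4 * (β * B ^ 2 + B * r) := by
      have : (n : ℝ) = √n * √n := (Real.mul_self_sqrt hn'.le).symm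
      simp only [a, b]
      rw [mul_add, mul_div_cancel₀ _ (by positivity)]
      congr 1
      rw [this]
      field_simp
      rw [Real.sqrt_sq hsn.le]
      ring
    exact le_of_mul_le_mul_left (hkey.trans h7.ge) (by positivity)
  -- If e > 2a + √b, then e² > 2ae + b, contradicting `hquad`.
  have h8 : b = √b ^ 2 := (Real.sq_sqrt hb).symm
  have h9 : 0 ≤ √b := Real.sqrt_nonneg _
  nlinarith

end Deterministic

/-! ### Conditioning i.i.d. samples on the features -/

section PiCompProd

variable {ι Z Y : Type*} [Fintype ι] [MeasurableSpace Z] [MeasurableSpace Y]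

/-- The product of copies of a Markov kernel. -/
noncomputable def piKernel (ι : Type*) [Fintype ι] (κ : Kernel Z Y) [IsMarkovKernel κ] :
    Kernel (ι → Z) (ι → Y) where
  toFun z := Measure.pi fun i => κ (z i)
  measurable' := by
    refine Measurable.measure_of_isPiSystem_of_isProbabilityMeasure generateFrom_pi.symm
      isPiSystem_pi ?_
    rintro _ ⟨s, hs, rfl⟩
    simp_rw [Measure.pi_pi]
    exact Finset.measurable_prod _ fun i _ =>
      (κ.measurable_coe (hs i trivial)).comp (measurable_pi_apply i)

instance isMarkovKernel_piKernel (κ : Kernel Z Y) [IsMarkovKernel κ] :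
    IsMarkovKernel (piKernel ι κ) :=
  ⟨fun z => inferInstanceAs (IsProbabilityMeasure (Measure.pi fun i => κ (z i)))⟩

/-- Drawing pairs independently is drawing all features and then independent labels given them; it
suffices to compare boxes. -/
theorem pi_compProd (ν : Measure Z) [IsProbabilityMeasure ν] (κ : Kernel Z Y) [IsMarkovKernel κ] :
    (Measure.pi fun _ : ι => ν ⊗ₘ κ) =
      ((Measure.pi fun _ : ι => ν) ⊗ₘ piKernel ι κ).map fun p i => (p.1 i, p.2 i) := by
  have hm : Measurable fun (p : (ι → Z) × (ι → Y)) (i : ι) => (p.1 i, p.2 i) := by fun_prop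
  refine Measure.pi_eq fun s hs => ?_
  rw [Measure.map_apply hm (MeasurableSet.univ_pi hs),
    Measure.compProd_apply (hm (MeasurableSet.univ_pi hs))]
  simp_rw [Measure.compProd_apply (hs _)]
  rw [← lintegral_pi_prod _ (fun i z => κ z (Prod.mk z ⁻¹' s i))
    fun i => Kernel.measurable_kernel_prodMk_left (hs i)]
  refine lintegral_congr fun z => ?_
  change (Measure.pi fun i => κ (z i)) _ = _
  rw [← Measure.pi_pi]
  congr 1

/-- Reduces a probability over the samples to a bound uniform over fixed designs. -/
theorem pi_compProd_le (ν : Measure Z) [IsProbabilityMeasure ν] (κ : Kernel Z Y)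
    [IsMarkovKernel κ] {s : Set (ι → Z × Y)} (hs : MeasurableSet s) {c : ℝ≥0∞}
    (h : ∀ z : ι → Z, Measure.pi (fun i => κ (z i)) {y | (fun i => (z i, y i)) ∈ s} ≤ c) :
    (Measure.pi fun _ : ι => ν ⊗ₘ κ) s ≤ c := by
  have hm : Measurable fun (p : (ι → Z) × (ι → Y)) (i : ι) => (p.1 i, p.2 i) := by fun_prop
  rw [pi_compProd, Measure.map_apply hm hs, Measure.compProd_apply (hm hs)]
  calc _ ≤ ∫⁻ _, c ∂Measure.pi fun _ : ι => ν := lintegral_mono h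
    _ = c := by simp

end PiCompProd

/-! ### The score of a fixed design -/

theorem lintegral_pi_gaussian_exp_linear {ι : Type*} [Fintype ι] (a : ι → ℝ) :
    ∫⁻ x, ENNReal.ofReal (Real.exp (∑ i, a i * x i)) ∂Measure.pi (fun _ : ι => gaussianReal 0 1) =
      ENNReal.ofReal (Real.exp ((∑ i, a i ^ 2) / 2)) := by
  rw [← mul_one (ENNReal.ofReal (Real.exp ((∑ i, a i ^ 2) / 2))), ← lintegral_pi_gaussian_exp a,
    ← lintegral_const_mul _ (by fun_prop)]
  refine lintegral_congr fun x => ?_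
  rw [← ENNReal.ofReal_mul (Real.exp_pos _).le, ← Real.exp_add, Finset.sum_sub_distrib,
    Finset.sum_div]
  ring_nf

theorem lintegral_pi_gaussian_exp_sq (k : ℕ) :
    ∫⁻ x, ENNReal.ofReal (Real.exp (∑ i, x i ^ 2 / 8))
      ∂Measure.pi (fun _ : Fin k => gaussianReal 0 1) = sqExpMoment ^ k := by
  rw [lintegral_exp_sum_pi _ (fun _ x => x ^ 2 / 8) fun _ => by fun_prop]
  simp [sqExpMoment]

section Score

variable {n d : ℕ}

open Module in
/-- The exponential square moment of the projection of a sub-Gaussian vector to a subspace. -/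
theorem lintegral_exp_norm_sq_orthogonalProjection_le {Y : Fin n → Type*}
    [∀ i, MeasurableSpace (Y i)]
    (P : ∀ i, Measure (Y i)) [∀ i, IsProbabilityMeasure (P i)] {ξ : ∀ i, Y i → ℝ}
    (hξ : ∀ i, Measurable (ξ i))
    (hsub : ∀ i s, ∫⁻ y, ENNReal.ofReal (Real.exp (s * ξ i y)) ∂P i ≤
      ENNReal.ofReal (Real.exp (s ^ 2 / 8)))
    (W : Submodule ℝ (EuclideanSpace ℝ (Fin n))) :
    ∫⁻ y, ENNReal.ofReal (Real.exp
      (‖W.orthogonalProjectionOnto (WithLp.toLp 2 fun i => ξ i (y i))‖ ^ 2 / 2)) ∂Measure.pi P ≤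
        sqExpMoment ^ finrank ℝ W := by
  set b := stdOrthonormalBasis ℝ W
  set G := Measure.pi fun _ : Fin (finrank ℝ W) => gaussianReal 0 1
  set a : (Fin (finrank ℝ W) → ℝ) → Fin n → ℝ :=
    fun g i => ((∑ j, g j • b j : W) : EuclideanSpace ℝ (Fin n)) i with ha
  have ha_meas : ∀ i, Measurable fun g => a g i := by
    intro i
    simp only [ha, Submodule.coe_sum, Submodule.coe_smul, WithLp.ofLp_sum, WithLp.ofLp_smul,
      Finset.sum_apply, Pi.smul_apply, smul_eq_mul]
    fun_prop
  have ha_sq : ∀ g, ∑ i, a g i ^ 2 = ∑ j, g j ^ 2 := by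
    intro g
    rw [← EuclideanSpace.real_norm_sq_eq, ← Submodule.coe_norm, ← real_inner_self_eq_norm_sq,
      b.orthonormal.inner_sum]
    simp [sq]
  have hlin : ∀ (y : ∀ i, Y i) (g : Fin (finrank ℝ W) → ℝ),
      ∑ j, inner ℝ (b j) (W.orthogonalProjectionOnto (WithLp.toLp 2 fun i => ξ i (y i))) * g j =
        ∑ i, a g i * ξ i (y i) := by
    intro y g
    calc _ = inner ℝ (∑ j, g j • b j)
          (W.orthogonalProjectionOnto (WithLp.toLp 2 fun i => ξ i (y i))) := by
          rw [sum_inner]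
          exact Finset.sum_congr rfl fun j _ => by
            rw [mul_comm]
            exact (real_inner_smul_left (b j) _ (g j)).symm
      _ = inner ℝ ((∑ j, g j • b j : W) : EuclideanSpace ℝ (Fin n))
          (WithLp.toLp 2 fun i => ξ i (y i)) :=
          Submodule.inner_orthogonalProjectionOnto_eq_of_mem_left _ _
      _ = _ := by
          rw [PiLp.inner_apply]
          exact Finset.sum_congr rfl fun i _ => by simp [ha, mul_comm]
  -- Gaussian linearization: exp(‖p‖²/2) is the mean of exp⟨g, p⟩ over a standard Gaussian g on `W`.
  -- After swapping integrals, ξ appears linearly, its coordinates factorize, and `hsub` leaves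
  -- exp(|g|²/8).
  have h1 : ∀ y : ∀ i, Y i, ENNReal.ofReal (Real.exp
      (‖W.orthogonalProjectionOnto (WithLp.toLp 2 fun i => ξ i (y i))‖ ^ 2 / 2)) =
        ∫⁻ g, ENNReal.ofReal (Real.exp (∑ i, a g i * ξ i (y i))) ∂G := by
    intro y
    simp_rw [← hlin]
    rw [lintegral_pi_gaussian_exp_linear, b.sum_sq_inner_right]
  simp_rw [h1]
  rw [lintegral_lintegral_swap]
  · calc _ ≤ ∫⁻ g, ENNReal.ofReal (Real.exp (∑ j, g j ^ 2 / 8)) ∂G := by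
          refine lintegral_mono fun g => ?_
          simp only
          rw [lintegral_exp_sum_pi P (fun i y => a g i * ξ i y) fun i => (hξ i).const_mul _]
          calc _ ≤ ∏ i, ENNReal.ofReal (Real.exp (a g i ^ 2 / 8)) :=
                Finset.prod_le_prod' fun i _ => hsub i (a g i)
            _ = _ := by
                rw [← ENNReal.ofReal_prod_of_nonneg fun i _ => (Real.exp_pos _).le,
                  ← Real.exp_sum, ← Finset.sum_div, ha_sq, Finset.sum_div]
      _ = _ := lintegral_pi_gaussian_exp_sq _
  · refine Measurable.aemeasurable (Measurable.ennreal_ofReal (Measurable.exp ?_))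
    refine Finset.measurable_sum _ fun i _ => ?_
    exact ((ha_meas i).comp measurable_snd).mul
      ((hξ i).comp ((measurable_pi_apply i).comp measurable_fst))

open Module in
-- The weighted sum is ⟨ξ, Xv⟩ = ⟨Pξ, Xv⟩, so Cauchy-Schwarz handles all v at once. The range of X
-- has dimension at most d whatever n is, and X may be rank deficient.
theorem measure_score_le {Y : Fin n → Type*} [∀ i, MeasurableSpace (Y i)]
    (P : ∀ i, Measure (Y i)) [∀ i, IsProbabilityMeasure (P i)] {ξ : ∀ i, Y i → ℝ}
    (hξ : ∀ i, Measurable (ξ i))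
    (hsub : ∀ i s, ∫⁻ y, ENNReal.ofReal (Real.exp (s * ξ i y)) ∂P i ≤
      ENNReal.ofReal (Real.exp (s ^ 2 / 8)))
    (x : Fin n → EuclideanSpace ℝ (Fin d)) {α : ℝ} (hα : 0 < α) :
    Measure.pi P {y | ∃ v : EuclideanSpace ℝ (Fin d),
      √(2 * (d * Real.log sqExpMoment.toReal + Real.log (1 / α))) *
        √(∑ i, (inner ℝ (x i) v) ^ 2) < ∑ i, ξ i (y i) * inner ℝ (x i) v} ≤
      ENNReal.ofReal α := by
  set X : EuclideanSpace ℝ (Fin d) →ₗ[ℝ] EuclideanSpace ℝ (Fin n) :=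
    (WithLp.linearEquiv 2 ℝ (Fin n → ℝ)).symm.toLinearMap ∘ₗ
      LinearMap.pi fun i => (innerSL ℝ (x i)).toLinearMap with hX
  have hXi : ∀ v i, X v i = inner ℝ (x i) v := fun v i => rfl
  set W := LinearMap.range X
  set p : (∀ i, Y i) → W := fun y =>
    W.orthogonalProjectionOnto (WithLp.toLp 2 fun i => ξ i (y i)) with hp
  have hpm : Measurable fun y => ‖p y‖ ^ 2 / 2 := by
    have h : Measurable fun y : ∀ i, Y i => fun i => ξ i (y i) :=
      measurable_pi_lambda _ fun i => (hξ i).comp (measurable_pi_apply i)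
    have h' : Measurable fun y : ∀ i, Y i => WithLp.toLp 2 fun i => ξ i (y i) :=
      (by fun_prop : Measurable (WithLp.toLp 2 : (Fin n → ℝ) → EuclideanSpace ℝ (Fin n))).comp h
    have h'' : Measurable p := W.orthogonalProjectionOnto.continuous.measurable.comp h'
    fun_prop
  have hK : 1 ≤ sqExpMoment.toReal := by
    rw [← ENNReal.toReal_one]
    exact ENNReal.toReal_mono sqExpMoment_ne_top one_le_sqExpMoment
  have hint : ∫⁻ y, ENNReal.ofReal (Real.exp (‖p y‖ ^ 2 / 2)) ∂Measure.pi P ≤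
      ENNReal.ofReal sqExpMoment.toReal ^ d := by
    rw [ENNReal.ofReal_toReal sqExpMoment_ne_top]
    refine (lintegral_exp_norm_sq_orthogonalProjection_le P hξ hsub W).trans
      (pow_le_pow_right₀ one_le_sqExpMoment ?_)
    simpa using LinearMap.finrank_range_le X
  refine (measure_mono ?_).trans (measure_le_of_lintegral_exp (Measure.pi P) hpm
    (zero_lt_one.trans_le hK) hα d hint)
  rintro y ⟨v, hv⟩
  have e1 : √(∑ i, (inner ℝ (x i) v) ^ 2) = ‖X v‖ := by
    rw [EuclideanSpace.norm_eq]
    simp [hXi]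
  have e2 : ∑ i, ξ i (y i) * inner ℝ (x i) v = inner ℝ (p y) (⟨X v, v, rfl⟩ : W) := by
    rw [hp, Submodule.coe_inner, real_inner_comm,
      ← Submodule.coe_inner W ⟨X v, v, rfl⟩,
      Submodule.inner_orthogonalProjectionOnto_eq_of_mem_left, PiLp.inner_apply]
    exact Finset.sum_congr rfl fun i _ => by simp [hXi]
  rw [e1, e2] at hv
  have h3 : inner ℝ (p y) (⟨X v, v, rfl⟩ : W) ≤ ‖p y‖ * ‖X v‖ := real_inner_le_norm _ _
  have h4 : √(2 * (d * Real.log sqExpMoment.toReal + Real.log (1 / α))) ≤ ‖p y‖ := by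
    by_contra! hlt
    have := mul_le_mul_of_nonneg_right hlt.le (norm_nonneg (X v))
    linarith
  have h5 := (Real.sqrt_le_left (norm_nonneg _)).1 h4
  change _ ≤ ‖p y‖ ^ 2 / 2
  linarith

end Score

/-! ### Residuals of the label model -/

theorem labelProb_true {S A : Type*} {d : ℕ} (φ : S → A → EuclideanSpace ℝ (Fin d)) (θ : EuclideanSpace ℝ (Fin d))
    (z : S × (A × A)) :
    labelProb φ θ z true = Real.sigmoid (inner ℝ (diffFeature φ z) θ) := by
  simp only [labelProb, reward, diffFeature, if_true, inner_sub_left, Real.sigmoid_def]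
  rw [neg_sub, Real.exp_sub]
  have h1 := Real.exp_pos (inner ℝ (φ z.1 z.2.1) θ)
  have h2 := Real.exp_pos (inner ℝ (φ z.1 z.2.2) θ)
  field_simp
  ring

theorem labelProb_false {S A : Type*} {d : ℕ} (φ : S → A → EuclideanSpace ℝ (Fin d)) (θ : EuclideanSpace ℝ (Fin d))
    (z : S × (A × A)) :
    labelProb φ θ z false = 1 - Real.sigmoid (inner ℝ (diffFeature φ z) θ) := by
  rw [← labelProb_true]
  simp only [labelProb, if_true, Bool.false_eq_true, if_false]
  have h1 := Real.exp_pos (reward φ θ z.1 z.2.1)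
  have h2 := Real.exp_pos (reward φ θ z.1 z.2.2)
  field_simp
  ring

section Label

variable {S A : Type*} [MeasurableSpace S] [MeasurableSpace A] {d : ℕ}

theorem integral_labelKernel {φ : S → A → EuclideanSpace ℝ (Fin d)}
    (hφ : Measurable (Function.uncurry φ)) (θ : EuclideanSpace ℝ (Fin d)) (z : S × (A × A))
    (f : Bool → ℝ) :
    ∫ y, f y ∂labelKernel φ hφ θ z =
      labelProb φ θ z true * f true + labelProb φ θ z false * f false := by
  have h : ∀ l, 0 ≤ labelProb φ θ z l := fun l => by unfold labelProb; positivity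
  change ∫ y, f y ∂(ENNReal.ofReal (labelProb φ θ z true) • Measure.dirac true +
    ENNReal.ofReal (labelProb φ θ z false) • Measure.dirac false) = _
  have hi : ∀ l, Integrable f (ENNReal.ofReal (labelProb φ θ z l) • Measure.dirac l) := fun l =>
    (Integrable.of_finite (μ := Measure.dirac l)).smul_measure ENNReal.ofReal_ne_top
  rw [integral_add_measure (hi true) (hi false), integral_smul_measure, integral_smul_measure,
    integral_dirac, integral_dirac, ENNReal.toReal_ofReal (h true), ENNReal.toReal_ofReal (h false),
    smul_eq_mul, smul_eq_mul]

/-- Hoeffding's bound for the residuals. -/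
theorem lintegral_exp_resid_le {φ : S → A → EuclideanSpace ℝ (Fin d)}
    (hφ : Measurable (Function.uncurry φ)) (θ : EuclideanSpace ℝ (Fin d)) (z : S × (A × A))
    (s : ℝ) :
    ∫⁻ y, ENNReal.ofReal (Real.exp (s * resid θ (diffFeature φ z) y)) ∂labelKernel φ hφ θ z ≤
      ENNReal.ofReal (Real.exp (s ^ 2 / 8)) := by
  set q := Real.sigmoid (inner ℝ (diffFeature φ z) θ) with hq
  -- The residual is centred and takes values in an interval of length 1, hence the variance proxy
  -- 1/4 and the exponent s²/8.
  have h := hasSubgaussianMGF_of_mem_Icc_of_integral_eq_zero (μ := labelKernel φ hφ θ z)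
    (X := resid θ (diffFeature φ z)) (a := -q) (b := 1 - q) Measurable.of_discrete.aemeasurable
    (Filter.Eventually.of_forall fun y => by
      rw [resid, ← hq, labelVal]
      split_ifs <;> constructor <;> linarith)
    (by
      rw [integral_labelKernel, labelProb_true, labelProb_false, resid, resid, ← hq]
      simp [labelVal]
      ring)
  rw [← ofReal_integral_eq_lintegral_ofReal (h.integrable_exp_mul s)
    (Filter.Eventually.of_forall fun _ => (Real.exp_pos _).le)]
  refine ENNReal.ofReal_le_ofReal ((h.mgf_le s).trans (le_of_eq ?_))
  congr 1
  simp
  ring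

theorem measurable_diffFeature {φ : S → A → EuclideanSpace ℝ (Fin d)}
    (hφ : Measurable (Function.uncurry φ)) : Measurable (diffFeature φ) :=
  (hφ.comp (measurable_fst.prodMk (measurable_snd.comp measurable_snd))).sub
    (hφ.comp (measurable_fst.prodMk (measurable_fst.comp measurable_snd)))

theorem measurable_resid {φ : S → A → EuclideanSpace ℝ (Fin d)}
    (hφ : Measurable (Function.uncurry φ)) (θ : EuclideanSpace ℝ (Fin d)) :
    Measurable fun p : (S × (A × A)) × Bool => resid θ (diffFeature φ p.1) p.2 := by
  have h1 : Measurable labelVal := Measurable.of_discrete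
  have h2 := measurable_diffFeature hφ
  unfold resid
  refine (h1.comp measurable_snd).sub (continuous_sigmoid.measurable.comp ?_)
  fun_prop

/-- The score bound fails with probability at most `α`. -/
theorem sampleLaw_score_le {n : ℕ} {φ : S → A → EuclideanSpace ℝ (Fin d)}
    (hφ : Measurable (Function.uncurry φ)) (θ : EuclideanSpace ℝ (Fin d))
    (ρ : Measure S) [IsProbabilityMeasure ρ] (μ : Kernel S (A × A)) [IsMarkovKernel μ]
    {α : ℝ} (hα : 0 < α) :
    (Measure.pi fun _ : Fin n => sampleLaw φ hφ θ ρ μ)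
      {D | ∃ v : EuclideanSpace ℝ (Fin d),
        √(2 * (d * Real.log sqExpMoment.toReal + Real.log (1 / α))) *
          √(∑ i, (inner ℝ (diffFeature φ (D i).1) v) ^ 2) <
            ∑ i, resid θ (diffFeature φ (D i).1) (D i).2 * inner ℝ (diffFeature φ (D i).1) v} ≤
      ENNReal.ofReal α := by
  set c := √(2 * (d * Real.log sqExpMoment.toReal + Real.log (1 / α)))
  have hx : ∀ i, Measurable fun D : Fin n → (S × (A × A)) × Bool => diffFeature φ (D i).1 :=
    fun i => (measurable_diffFeature hφ).comp (measurable_fst.comp (measurable_pi_apply i))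
  have hr : ∀ i, Measurable fun D : Fin n → (S × (A × A)) × Bool =>
      resid θ (diffFeature φ (D i).1) (D i).2 :=
    fun i => (measurable_resid hφ θ).comp (measurable_pi_apply i)
  refine pi_compProd_le (ρ ⊗ₘ μ) (labelKernel φ hφ θ) ?_ fun z =>
    measure_score_le (fun i => labelKernel φ hφ θ (z i))
      (ξ := fun i y => resid θ (diffFeature φ (z i)) y) (fun i => Measurable.of_discrete)
      (fun i s => lintegral_exp_resid_le hφ θ (z i) s) (fun i => diffFeature φ (z i)) hα
  -- The strict inequality is an open condition on v, so a countable dense set of v suffices, which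
  -- gives measurability.
  have hset : {D : Fin n → (S × (A × A)) × Bool | ∃ v : EuclideanSpace ℝ (Fin d),
        c * √(∑ i, (inner ℝ (diffFeature φ (D i).1) v) ^ 2) <
          ∑ i, resid θ (diffFeature φ (D i).1) (D i).2 * inner ℝ (diffFeature φ (D i).1) v} =
      ⋃ k, {D | c * √(∑ i, (inner ℝ (diffFeature φ (D i).1)
          (TopologicalSpace.denseSeq (EuclideanSpace ℝ (Fin d)) k)) ^ 2) <
          ∑ i, resid θ (diffFeature φ (D i).1) (D i).2 * inner ℝ (diffFeature φ (D i).1)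
            (TopologicalSpace.denseSeq (EuclideanSpace ℝ (Fin d)) k)} := by
    ext D
    simp only [Set.mem_ofPred_eq, Set.mem_iUnion]
    constructor
    · rintro ⟨v, hv⟩
      have ho : IsOpen {v : EuclideanSpace ℝ (Fin d) |
          c * √(∑ i, (inner ℝ (diffFeature φ (D i).1) v) ^ 2) <
          ∑ i, resid θ (diffFeature φ (D i).1) (D i).2 * inner ℝ (diffFeature φ (D i).1) v} :=
        isOpen_lt (by fun_prop) (by fun_prop)
      obtain ⟨_, h, k, rfl⟩ := (TopologicalSpace.denseRange_denseSeq
        (EuclideanSpace ℝ (Fin d))).inter_open_nonempty _ ho ⟨v, hv⟩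
      exact ⟨k, h⟩
    · rintro ⟨k, hk⟩
      exact ⟨_, hk⟩
  rw [hset]
  refine MeasurableSet.iUnion fun k => measurableSet_lt ?_ ?_
  · fun_prop
  · fun_prop

end Label

/-! ### Noise norm, constants and assembly -/

theorem noiseLaw_norm_le {d : ℕ} {σ α : ℝ} (hσ : 0 < σ) (hα : 0 < α) :
    noiseLaw d σ {w | d * Real.log sqExpMoment.toReal + Real.log (1 / α) ≤
      ‖w‖ ^ 2 / (8 * σ ^ 2)} ≤ ENNReal.ofReal α := by
  have hK : 1 ≤ sqExpMoment.toReal := by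
    rw [← ENNReal.toReal_one]
    exact ENNReal.toReal_mono sqExpMoment_ne_top one_le_sqExpMoment
  refine measure_le_of_lintegral_exp _ (by fun_prop) (zero_lt_one.trans_le hK) hα d ?_
  rw [noiseLaw, ← map_pi_eq_stdGaussian, Measure.map_map (by fun_prop) (by fun_prop),
    lintegral_map (by fun_prop) (by fun_prop), ENNReal.ofReal_toReal sqExpMoment_ne_top,
    ← lintegral_pi_gaussian_exp_sq]
  refine le_of_eq (lintegral_congr fun x => ?_)
  congr 2
  rw [Function.comp_apply, norm_smul, mul_pow, EuclideanSpace.real_norm_sq_eq, Real.norm_eq_abs,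
    sq_abs, ← Finset.sum_div]
  field_simp

/-- The constant of the error bound for all noise levels. -/
noncomputable def errConst (α₀ : ℝ) : ℝ :=
  2 * √(2 * (Real.log sqExpMoment.toReal + 1)) +
    √(4 * (1 + √(8 * ((Real.log sqExpMoment.toReal + 1) * (1 / Real.log (1 / α₀) + 1)))))

theorem log_sqExpMoment_nonneg : 0 ≤ Real.log sqExpMoment.toReal := by
  refine Real.log_nonneg ?_
  rw [← ENNReal.toReal_one]
  exact ENNReal.toReal_mono sqExpMoment_ne_top one_le_sqExpMoment

theorem errConst_pos (α₀ : ℝ) : 0 < errConst α₀ := by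
  have := log_sqExpMoment_nonneg
  unfold errConst
  positivity

theorem deterministic_bound_le {d n : ℕ} (hd : 0 < d) (hn : 0 < n) {L B σ α₀ α : ℝ} (hB : 0 < B)
    (hσ : 0 < σ) (hα₀' : α₀ < 1) (hα : 0 < α) (hαα : α ≤ α₀) :
    2 * (√(2 * (d * Real.log sqExpMoment.toReal + Real.log (1 / (α / 2)))) / (gam L B * √n)) +
      √(4 * (regBeta d B σ α * B ^ 2 + B *
        (σ * √(8 * (d * Real.log sqExpMoment.toReal + Real.log (1 / (α / 2)))))) /
          (gam L B * n)) ≤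
    errConst α₀ * (1 / gam L B * √((d + Real.log (1 / α)) / n) +
      √(σ * B) * (d * Real.log (1 / α)) ^ (1 / 4 : ℝ) / √(n * gam L B)) := by
  have hΛ := log_sqExpMoment_nonneg
  have hg := gam_pos L B
  have hα₀ : 0 < α₀ := hα.trans_le hαα
  have hℓ₀ : 0 < Real.log (1 / α₀) := Real.log_pos (by rwa [lt_div_iff₀ hα₀, one_mul])
  have hℓ : Real.log (1 / α₀) ≤ Real.log (1 / α) :=
    Real.log_le_log (by positivity) (one_div_le_one_div_of_le hα hαα)
  have hlog : Real.log (1 / (α / 2)) = Real.log 2 + Real.log (1 / α) := by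
    rw [← Real.log_mul (by norm_num) (by positivity)]
    congr 1
    field_simp
  have hlog2 : Real.log 2 ≤ 1 := by linarith [Real.log_two_lt_d9]
  have hd' : (1 : ℝ) ≤ d := Nat.one_le_cast.2 hd
  have hn' : (0 : ℝ) < n := Nat.cast_pos.2 hn
  rw [hlog, errConst, regBeta]
  set Λ := Real.log sqExpMoment.toReal
  set ℓ₀ := Real.log (1 / α₀)
  set ℓ := Real.log (1 / α)
  set γ := gam L B
  have hℓp : 0 < ℓ := hℓ₀.trans_le hℓ
  set M := d * Λ + (Real.log 2 + ℓ) with hM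
  -- Uses log 2 ≤ 1 ≤ d.
  have hM1 : M ≤ (Λ + 1) * (d + ℓ) := by nlinarith
  -- The only place where α ≤ α₀ < 1 matters quantitatively: log(1/α) ≥ log(1/α₀) turns d into a
  -- multiple of d · log(1/α).
  have hM2 : M ≤ (Λ + 1) * (1 / ℓ₀ + 1) * (d * ℓ) := by
    refine hM1.trans ?_
    rw [mul_assoc]
    refine mul_le_mul_of_nonneg_left ?_ (by positivity)
    have h1 : (d : ℝ) ≤ 1 / ℓ₀ * (d * ℓ) := by
      rw [one_div_mul_eq_div, le_div_iff₀ hℓ₀]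
      gcongr
    have h2 : ℓ ≤ d * ℓ := by nlinarith
    linarith
  set κ := (Λ + 1) * (1 / ℓ₀ + 1) with hκ
  have hκ0 : 0 ≤ κ := by positivity
  set p := √(2 * (Λ + 1)) with hp
  set q := √(4 * (1 + √(8 * κ))) with hq
  have hterm1 : 2 * (√(2 * M) / (γ * √n)) ≤ 2 * p * (1 / γ * √((d + ℓ) / n)) := by
    have h1 : √(2 * M) ≤ p * √(d + ℓ) := by
      rw [hp, ← Real.sqrt_mul (by positivity)]
      exact Real.sqrt_le_sqrt (by linarith)
    calc 2 * (√(2 * M) / (γ * √n)) ≤ 2 * (p * √(d + ℓ) / (γ * √n)) := by gcongr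
      _ = _ := by
        rw [Real.sqrt_div (by positivity)]
        field_simp
  -- Both βB² and the bound on B‖w‖ are multiples of σB√(d log(1/α)); the outer root produces the
  -- power 1/4.
  have hterm2 : √(4 * (σ * √(d * ℓ) / B * B ^ 2 + B * (σ * √(8 * M))) / (γ * n)) ≤
      q * (√(σ * B) * (d * ℓ) ^ (1 / 4 : ℝ) / √(n * γ)) := by
    have h1 : √(8 * M) ≤ √(8 * κ) * √(d * ℓ) := by
      rw [← Real.sqrt_mul (by positivity)]
      exact Real.sqrt_le_sqrt (by linarith)
    have h2 : (d * ℓ : ℝ) ^ (1 / 4 : ℝ) = √(√(d * ℓ)) := by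
      rw [Real.sqrt_eq_rpow, Real.sqrt_eq_rpow, ← Real.rpow_mul (by positivity)]
      norm_num
    rw [h2, hq, ← Real.sqrt_mul (by positivity), ← Real.sqrt_div (by positivity),
      ← Real.sqrt_mul (by positivity)]
    refine Real.sqrt_le_sqrt ?_
    calc 4 * (σ * √(d * ℓ) / B * B ^ 2 + B * (σ * √(8 * M))) / (γ * n) ≤
        4 * (σ * √(d * ℓ) / B * B ^ 2 + B * (σ * (√(8 * κ) * √(d * ℓ)))) / (γ * n) := by gcongr
      _ = _ := by field_simp
  have hp0 : 0 ≤ p := Real.sqrt_nonneg _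
  have hq0 : 0 ≤ q := Real.sqrt_nonneg _
  have h3 : 0 ≤ 2 * p * (√(σ * B) * (d * ℓ) ^ (1 / 4 : ℝ) / √(n * γ)) := by positivity
  have h4 : 0 ≤ q * (1 / γ * √((d + ℓ) / n)) := by positivity
  refine (add_le_add hterm1 hterm2).trans ?_
  linarith

section Utility

variable {S A : Type*} [MeasurableSpace S] [MeasurableSpace A] {d n : ℕ}

/-- The error bound for every noise level `σ`. -/
theorem estError_le (hd : 0 < d) (hn : 0 < n) {L B : ℝ} (hB : 0 < B)
    {φ : S → A → EuclideanSpace ℝ (Fin d)} (hφ : Measurable (Function.uncurry φ))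
    (hL : ∀ s a, ‖φ s a‖ ≤ L) (ρ : Measure S) [IsProbabilityMeasure ρ] (μ : Kernel S (A × A))
    [IsMarkovKernel μ] {θs : EuclideanSpace ℝ (Fin d)} (hθs : θs ∈ paramSet d B) {α₀ α : ℝ}
    (hα₀' : α₀ < 1) (hα : 0 < α) (hαα : α ≤ α₀) {σ : ℝ} (hσ : 0 < σ) {b : ℝ}
    (hb : errConst α₀ * (1 / gam L B * √((d + Real.log (1 / α)) / n) +
      √(σ * B) * (d * Real.log (1 / α)) ^ (1 / 4 : ℝ) / √(n * gam L B)) ≤ b) :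
    ((Measure.pi fun _ : Fin n => sampleLaw φ hφ θs ρ μ).prod (noiseLaw d σ))
      {p | ¬ estError φ L B σ α θs p.1 p.2 ≤ b} ≤ ENNReal.ofReal α := by
  have hα2 : 0 < α / 2 := by positivity
  have hg := gam_pos L B
  set M := d * Real.log sqExpMoment.toReal + Real.log (1 / (α / 2)) with hM
  have h1 := sampleLaw_score_le (n := n) hφ θs ρ μ hα2
  have h2 := noiseLaw_norm_le (d := d) hσ hα2
  rw [← hM] at h1 h2
  set E₁ := {D : Fin n → (S × (A × A)) × Bool | ∃ v : EuclideanSpace ℝ (Fin d),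
        √(2 * M) * √(∑ i, (inner ℝ (diffFeature φ (D i).1) v) ^ 2) <
          ∑ i, resid θs (diffFeature φ (D i).1) (D i).2 * inner ℝ (diffFeature φ (D i).1) v}
  set E₂ := {w : EuclideanSpace ℝ (Fin d) | M ≤ ‖w‖ ^ 2 / (8 * σ ^ 2)}
  have : IsProbabilityMeasure (sampleLaw φ hφ θs ρ μ) := by unfold sampleLaw; infer_instance
  have : IsProbabilityMeasure (noiseLaw d σ) :=
    Measure.isProbabilityMeasure_map (by fun_prop)
  -- The failure event lies in a union of two cylinders of mass at most α/2 each; monotonicity of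
  -- the outer measure requires no measurability of this event.
  have hsub : {p : (Fin n → (S × (A × A)) × Bool) × EuclideanSpace ℝ (Fin d) |
      ¬ estError φ L B σ α θs p.1 p.2 ≤ b} ⊆ E₁ ×ˢ Set.univ ∪ Set.univ ×ˢ E₂ := by
    rintro ⟨D, w⟩ hp
    by_contra hmem
    simp only [Set.mem_union, Set.mem_prod, Set.mem_univ, and_true, true_and, not_or] at hmem
    refine hp (le_trans ?_ hb)
    obtain ⟨hD, hw⟩ := hmem
    have hD' : ∀ v : EuclideanSpace ℝ (Fin d),
        ∑ i, resid θs (diffFeature φ (D i).1) (D i).2 * inner ℝ (diffFeature φ (D i).1) v ≤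
          √(2 * M) * √(∑ i, (inner ℝ (diffFeature φ (D i).1) v) ^ 2) := by
      intro v
      by_contra! h
      exact hD ⟨v, h⟩
    have hw' : ‖w‖ ≤ σ * √(8 * M) := by
      have h : ‖w‖ ^ 2 / (8 * σ ^ 2) < M := not_le.1 hw
      rw [div_lt_iff₀ (by positivity)] at h
      calc ‖w‖ = √(‖w‖ ^ 2) := (Real.sqrt_sq (norm_nonneg w)).symm
        _ ≤ √(σ ^ 2 * (8 * M)) := Real.sqrt_le_sqrt (by linarith)
        _ = σ * √(8 * M) := by rw [Real.sqrt_mul (by positivity), Real.sqrt_sq hσ.le]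
    have hn' : (0 : ℝ) < n := Nat.cast_pos.2 hn
    refine (matNorm_objPert_sub_le hn hB (by unfold regBeta; positivity) (Real.sqrt_nonneg _)
      (by unfold lam; positivity) ?_ (fun i => norm_diffFeature_le hL (D i).1)
      (fun i => (D i).2) hθs hw' hD').trans
      (deterministic_bound_le hd hn hB hσ hα₀' hα hαα)
    rw [lam, regBeta]
    field_simp
  calc _ ≤ _ := measure_mono hsub
    _ ≤ _ := measure_union_le _ _
    _ ≤ ENNReal.ofReal (α / 2) + ENNReal.ofReal (α / 2) := by
        rw [Measure.prod_prod, Measure.prod_prod, measure_univ, measure_univ, mul_one, one_mul]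
        exact add_le_add h1 h2
    _ = ENNReal.ofReal α := by
        rw [← ENNReal.ofReal_add hα2.le hα2.le, add_halves]

end Utility

/-- 8 log(2/δ) + 4ε ≤ 16(log(2/δ) + 4ε), and the factor 2 is the fourth root of 16. -/
theorem sqrt_privSigma_mul_le {L B ε δ t : ℝ} (hL : 0 < L) (hB : 0 < B) (hε : 0 < ε) (hδ : 0 < δ)
    (hδ1 : δ < 1) (ht : 0 ≤ t) {m : ℝ} (hm : 0 < m) :
    √(privSigma L ε δ * B) * t ^ (1 / 4 : ℝ) / √m ≤
      2 * (√(L * B) * ((Real.log (2 / δ) + 4 * ε) * t) ^ (1 / 4 : ℝ) / √(ε * m)) := by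
  have hl : 0 < Real.log (2 / δ) := Real.log_pos (by rw [lt_div_iff₀ hδ]; linarith)
  have h4 : ∀ z : ℝ, 0 ≤ z → z ^ (1 / 4 : ℝ) = √(√z) := fun z hz => by
    rw [Real.sqrt_eq_rpow, Real.sqrt_eq_rpow, ← Real.rpow_mul hz]
    norm_num
  have h2 : (2 : ℝ) = √(√16) := by
    rw [show (16 : ℝ) = (2 ^ 2) ^ 2 by norm_num, Real.sqrt_sq (by norm_num),
      Real.sqrt_sq (by norm_num)]
  rw [h4 t ht, h4 _ (by positivity), privSigma]
  calc _ = √(L * B) * √(√((8 * Real.log (2 / δ) + 4 * ε) * t)) / √(ε * m) := by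
        rw [← Real.sqrt_mul (by positivity), ← Real.sqrt_mul (by positivity),
          ← Real.sqrt_div (by positivity), ← Real.sqrt_div (by positivity),
          Real.sqrt_mul (by positivity) t]
        congr 1
        field_simp
    _ ≤ √(L * B) * √(√(16 * ((Real.log (2 / δ) + 4 * ε) * t))) / √(ε * m) := by
        gcongr √(L * B) * √(√?_) / √(ε * m)
        rw [← mul_assoc]
        gcongr
        linarith
    _ = _ := by
        rw [Real.sqrt_mul (x := 16) (by norm_num), Real.sqrt_mul (x := √16) (by positivity), ← h2]
        ring

end BTL

theorem mainTheorem11 (α₀ : ℝ) (hα₀ : 0 < α₀) (hα₀' : α₀ < 1) :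
    ∃ C : ℝ, 0 < C ∧
      ∀ (S : Type u) (A : Type v) [MeasurableSpace S] [MeasurableSpace A]
        (d n : ℕ) (_ : 0 < d) (_ : 0 < n) (L B : ℝ) (_ : 0 < L) (_ : 0 < B)
        (φ : S → A → EuclideanSpace ℝ (Fin d)) (hφ : Measurable (Function.uncurry φ))
        (_ : ∀ s a, ‖φ s a‖ ≤ L)
        (ρ : Measure S) [IsProbabilityMeasure ρ] (μ : Kernel S (A × A)) [IsMarkovKernel μ]
        (θs : EuclideanSpace ℝ (Fin d)) (_ : θs ∈ BTL.paramSet d B)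
        (α : ℝ) (_ : 0 < α) (_ : α ≤ α₀),
        (∀ σ : ℝ, 0 < σ →
          ((Measure.pi fun _ : Fin n => BTL.sampleLaw φ hφ θs ρ μ).prod (BTL.noiseLaw d σ))
            {p | ¬ BTL.estError φ L B σ α θs p.1 p.2 ≤
              C * (1 / BTL.gam L B * Real.sqrt ((d + Real.log (1 / α)) / n) +
                Real.sqrt (σ * B) * (d * Real.log (1 / α)) ^ (1 / 4 : ℝ) /
                  Real.sqrt (n * BTL.gam L B))} ≤ ENNReal.ofReal α) ∧
        (∀ ε δ : ℝ, 0 < ε → 0 < δ → δ < 1 →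
          BTL.IsLabelDP (n := n) (BTL.noiseLaw d (BTL.privSigma L ε δ))
            (BTL.estimator φ B (BTL.regBeta d B (BTL.privSigma L ε δ) α)) ε δ ∧
          ((Measure.pi fun _ : Fin n => BTL.sampleLaw φ hφ θs ρ μ).prod
              (BTL.noiseLaw d (BTL.privSigma L ε δ)))
            {p | ¬ BTL.estError φ L B (BTL.privSigma L ε δ) α θs p.1 p.2 ≤
              C * (1 / BTL.gam L B * Real.sqrt ((d + Real.log (1 / α)) / n) +
                Real.sqrt (L * B) *
                    ((Real.log (2 / δ) + 4 * ε) * d * Real.log (1 / α)) ^ (1 / 4 : ℝ) /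
                  Real.sqrt (n * ε * BTL.gam L B))} ≤ ENNReal.ofReal α) := by
  -- The doubling is needed only for the private noise level, through `sqrt_privSigma_mul_le`.
  refine ⟨2 * BTL.errConst α₀, by have := BTL.errConst_pos α₀; positivity, ?_⟩
  intro S A _ _ d n hd hn L B hL hB φ hφ hφL ρ _ μ _ θs hθs α hα hαα
  have hC := BTL.errConst_pos α₀
  have hg := BTL.gam_pos L B
  have hlog : 0 ≤ Real.log (1 / α) := Real.log_nonneg (by rw [le_div_iff₀ hα]; linarith)
  have hn' : (0 : ℝ) < n := Nat.cast_pos.2 hn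
  refine ⟨fun σ hσ => ?_, fun ε δ hε hδ hδ1 => ⟨?_, ?_⟩⟩
  · refine BTL.estError_le hd hn hB hφ hφL ρ μ hθs hα₀' hα hαα hσ ?_
    exact mul_le_mul_of_nonneg_right (by linarith) (by positivity)
  · exact BTL.isLabelDP_estimator hL hφL B _ hε hδ hδ1
  · refine BTL.estError_le hd hn hB hφ hφL ρ μ hθs hα₀' hα hαα
      (BTL.privSigma_pos hL hε hδ hδ1) ?_
    have h := BTL.sqrt_privSigma_mul_le hL hB hε hδ hδ1
      (t := d * Real.log (1 / α)) (by positivity) (m := n * BTL.gam L B) (by positivity)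
    have e1 : ε * (n * BTL.gam L B) = n * ε * BTL.gam L B := by ring
    rw [← mul_assoc (Real.log (2 / δ) + 4 * ε), e1] at h
    have h0 : 0 ≤ 1 / BTL.gam L B * √((d + Real.log (1 / α)) / n) := by positivity
    rw [mul_comm 2, mul_assoc]
    refine mul_le_mul_of_nonneg_left ?_ hC.le
    linarith
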